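/- Let $D$ be a knot diagram on the sphere $S^2$ (equivalently, in the plane), with the crossings and the regions of $D$ defined as usual. A crossing \emph{touches} a region if the region occupies at least one of the four corners at the crossing. The \emph{region crossing change} at a region $R$ changes exactly the crossings that touch $R$; the \emph{region freeze crossing change} at $R$ changes exactly the crossings that do not touch $R$. Region crossing changes about a finite set $\mathcal{R}$ of regions means performing one region crossing change at each member of $\mathcal{R}$ (the order does not matter). A set $\mathcal{R}$ of regions is \emph{ineffective} if region crossing changes about $\mathcal{R}$ leave $D$ unchanged. Local moves on $D$ \emph{realize} the crossing change at a crossing $c$ if their result is the diagram obtained from $D$ by changing $c$ only. Assume that every ineffective set of regions of $D$ has even cardinality. Say that a crossing $c$ satisfies $(\star)$ if the crossing change at $c$ is realized by region crossing changes about some set consisting of an odd number of regions. Then the crossing change at every crossing of $D$ is realized by a sequence of region freeze crossing changes if and only if the number of crossings of $D$ satisfying $(\star)$ is even. Moreover, for each crossing $c$ satisfying $(\star)$ there are exactly four sets of regions about which region crossing changes realize the crossing change at $c$, and all four have odd cardinality. -/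

import Mathlib

/-- The set of cycles (orbits, fixed points included) of a permutation. -/
abbrev PermCycles {α : Type} (f : Equiv.Perm α) : Type :=
  Quotient (Equiv.Perm.SameCycle.setoid f)

/-- The projection of a knot to the sphere: a closed curve on the oriented sphere all of whose
multiple points are transverse double points, encoded as a combinatorial map. The double points cut
the curve into edges; a dart is an end of an edge at a double point. The permutation `rot` sends a
dart to the next one counterclockwise around the same double point, and `edge` sends a dart to the
other end of its edge. The crossing-free circle is the case in which there is no dart. -/
structure KnotProjection where
  /-- The ends of edges at double points. -/
  Dart : Type
  finite : Finite Dart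
  /-- The next dart, counterclockwise, around the same double point. -/
  rot : Equiv.Perm Dart
  /-- The other end of the same edge. -/
  edge : Equiv.Perm Dart
  /-- Exactly four darts leave each double point. -/
  rot_four : ∀ d, rot (rot (rot (rot d))) = d
  rot_two_ne : ∀ d, rot (rot d) ≠ d
  /-- Each edge has exactly two ends. -/
  edge_edge : ∀ d, edge (edge d) = d
  edge_ne : ∀ d, edge d ≠ d
  /-- There is one component: moving along edges and going straight through double points
  (from `d` to the opposite dart `rot (rot d)`) one gets from any dart to any other one. -/
  one_component : ∀ d e : Dart, ∃ g ∈ Subgroup.closure {edge, rot * rot}, g d = e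
  /-- The surface is a sphere: `V - E + F = 2`, where the faces are the cycles of `rot * edge`. -/
  planar : Nonempty Dart →
    Nat.card (PermCycles rot) + Nat.card (PermCycles (rot * edge))
      = Nat.card (PermCycles edge) + 2

namespace KnotProjection

variable (P : KnotProjection)

/-- The crossings are the double points, that is, the cycles of `rot`. -/
abbrev Crossing : Type := PermCycles P.rot

/-- The regions are the faces of the combinatorial map, that is, the cycles of `rot * edge`
(such a cycle consists of the darts that have the region on their right-hand side). If there are no
crossings, the curve is a circle, and the regions are its two sides. -/
abbrev Region : Type := PermCycles (P.rot * P.edge) ⊕ {_side : Bool // IsEmpty P.Dart}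

/-- The crossing at which a dart is based. -/
def crossingOf (d : P.Dart) : P.Crossing := Quotient.mk _ d

/-- The region to the right of a dart; it occupies the corner between `rot⁻¹ d` and `d` at the
crossing of `d`. -/
def regionOf (d : P.Dart) : P.Region := Sum.inl (Quotient.mk _ d)

/-- A crossing touches a region if the region occupies one of the four corners at the crossing. -/
def Touches (c : P.Crossing) (R : P.Region) : Prop :=
  ∃ d : P.Dart, P.crossingOf d = c ∧ P.regionOf d = R

/-- A knot diagram with projection `P`: at each crossing, one of the two strands is declared to be
the over-strand. A strand consists of a dart `d` and the opposite dart `rot (rot d)`. -/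
@[ext] structure Diagram where
  /-- The dart lies on the over-strand at its crossing. -/
  isOver : P.Dart → Prop
  isOver_rot : ∀ d, isOver (P.rot d) ↔ ¬ isOver d

namespace Diagram

variable {P}

/-- Exchange over- and under-strand at exactly the crossings in `C`. -/
def change (C : Set P.Crossing) (D : P.Diagram) : P.Diagram where
  isOver d := Xor (D.isOver d) (P.crossingOf d ∈ C)
  isOver_rot d := by
    have h : P.crossingOf (P.rot d) = P.crossingOf d :=
      Quotient.sound ((Equiv.Perm.sameCycle_apply_left (f := P.rot)).2 (Equiv.Perm.SameCycle.refl _ _))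
    rw [h, D.isOver_rot]
    simp only [Xor]
    tauto

/-- The crossing change at `c`. -/
def crossingChange (c : P.Crossing) (D : P.Diagram) : P.Diagram := D.change {c}

/-- The region crossing change at `R`: change the crossings touching `R`. -/
def rcc (R : P.Region) (D : P.Diagram) : P.Diagram := D.change {c | P.Touches c R}

/-- The region freeze crossing change at `R`: change all crossings not touching `R`. -/
def rfcc (R : P.Region) (D : P.Diagram) : P.Diagram := D.change {c | ¬ P.Touches c R}

/-- Region crossing changes at two regions commute. -/
instance : LeftCommutative (rcc : P.Region → P.Diagram → P.Diagram) where
  left_comm R S D := by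
    ext d
    simp only [rcc, change, Xor, Set.mem_ofPred_eq]
    tauto

/-- Region crossing changes about a set of regions: one at each member, in any order. -/
def rccAbout (𝓡 : Finset P.Region) (D : P.Diagram) : P.Diagram := 𝓡.val.foldr rcc D

/-- The result of a sequence of region freeze crossing changes, performed in the given order. -/
def rfccSeq (l : List P.Region) (D : P.Diagram) : P.Diagram := l.foldl (fun D' R => D'.rfcc R) D

/-- A set of regions is ineffective if region crossing changes about it do not change `D`. -/
def Ineffective (D : P.Diagram) (𝓡 : Finset P.Region) : Prop := D.rccAbout 𝓡 = D

/-- Region crossing changes about the set `𝓡` realize the crossing change at `c`. -/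
def RccRealizes (D : P.Diagram) (𝓡 : Finset P.Region) (c : P.Crossing) : Prop :=
  D.rccAbout 𝓡 = D.crossingChange c

/-- Condition (⋆): the crossing change at `c` is realized by region crossing changes about a set
consisting of an odd number of regions. -/
def Star (D : P.Diagram) (c : P.Crossing) : Prop :=
  ∃ 𝓡 : Finset P.Region, Odd 𝓡.card ∧ D.RccRealizes 𝓡 c

end Diagram

end KnotProjection

noncomputable section

open Classical

namespace KnotProjection

variable {P : KnotProjection}

/-! Work over 𝔽₂. Region crossing changes act through the incidence map `touchSum` from sets of
regions to sets of crossings; freeze changes act through `touchSum` plus parity times the all-ones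
vector 𝟙. Once `touchSum` is onto, the evenness hypothesis says that parity vanishes on its kernel,
so parity is φ ∘ `touchSum` for a linear functional φ, and c satisfies (⋆) exactly when φ(e_c) = 1.
The effect of freeze changes is then v ↦ v + φ(v)𝟙, a rank-one perturbation of the identity, which
is onto iff φ(𝟙) = 0, that is, iff the number of (⋆) crossings is even. By Euler's formula there are
two more regions than crossings, so each fibre of `touchSum` has 2² elements, all of one parity.

The hard part is `touchSum_surjective`. The map `cornerSum`, which counts corners with multiplicity,
is easier: for a function in its kernel, the jump across the curve is the same all along the knot,
so the kernel has dimension at most 2 and Euler's formula makes the map onto. The two maps differ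
only at reducible crossings, those with two opposite corners in one region. These errors are removed
by induction on nested lobes of the knot (`IsLobe.separating_ssubset`). -/

instance : Finite P.Dart := P.finite
instance : Fintype P.Dart := Fintype.ofFinite _
instance : Fintype P.Crossing := Fintype.ofFinite _
instance : Fintype P.Region := Fintype.ofFinite _

/-! ### Darts around a crossing, and Euler's formula as a count of regions -/

theorem crossingOf_surjective : Function.Surjective P.crossingOf := Quotient.mk_surjective

theorem regionOf_surjective [Nonempty P.Dart] : Function.Surjective P.regionOf := by
  rintro (R | ⟨b, h⟩)
  · obtain ⟨d, rfl⟩ := Quotient.mk_surjective R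
    exact ⟨d, rfl⟩
  · exact (not_isEmpty_of_nonempty P.Dart h).elim

theorem regionOf_rot_edge (d : P.Dart) : P.regionOf (P.rot (P.edge d)) = P.regionOf d :=
  congrArg Sum.inl (Quotient.sound
    ((Equiv.Perm.sameCycle_apply_left (f := P.rot * P.edge)).2 (Equiv.Perm.SameCycle.refl _ _)))

theorem regionOf_edge (d : P.Dart) : P.regionOf (P.edge d) = P.regionOf (P.rot d) := by
  rw [← regionOf_rot_edge (P.edge d), P.edge_edge]

theorem crossingOf_rot (d : P.Dart) : P.crossingOf (P.rot d) = P.crossingOf d :=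
  Quotient.sound ((Equiv.Perm.sameCycle_apply_left (f := P.rot)).2 (Equiv.Perm.SameCycle.refl _ _))

theorem rot_ne (d : P.Dart) : P.rot d ≠ d := fun h => P.rot_two_ne d (by rw [h, h])

/-- The four darts at the crossing of `d`. -/
def dartsAt (d : P.Dart) : Finset P.Dart :=
  {d, P.rot d, P.rot (P.rot d), P.rot (P.rot (P.rot d))}

theorem filter_crossingOf (d : P.Dart) :
    Finset.univ.filter (fun e => P.crossingOf e = P.crossingOf d) = dartsAt d := by
  ext e
  simp only [Finset.mem_filter, Finset.mem_univ, true_and, dartsAt, Finset.mem_insert,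
    Finset.mem_singleton]
  constructor
  · intro h
    obtain ⟨n, hn⟩ := (Equiv.Perm.SameCycle.exists_nat_pow_eq (Quotient.exact h.symm))
    have key : ∀ n : ℕ, (P.rot ^ n) d = d ∨ (P.rot ^ n) d = P.rot d ∨
        (P.rot ^ n) d = P.rot (P.rot d) ∨ (P.rot ^ n) d = P.rot (P.rot (P.rot d)) := by
      intro n
      induction n with
      | zero => simp
      | succ k ih =>
        rw [pow_succ', Equiv.Perm.mul_apply]
        rcases ih with h | h | h | h <;> simp [h, P.rot_four]
    rw [← hn]
    exact key n
  · rintro (rfl | rfl | rfl | rfl) <;> simp only [crossingOf_rot]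

theorem sum_dartsAt {M : Type*} [AddCommMonoid M] (f : P.Dart → M) (d : P.Dart) :
    ∑ e ∈ dartsAt d, f e =
      f d + (f (P.rot d) + (f (P.rot (P.rot d)) + f (P.rot (P.rot (P.rot d))))) := by
  have h0 := P.rot_two_ne d
  have h2 := rot_ne d
  have h5 := rot_ne (P.rot (P.rot (P.rot d)))
  rw [P.rot_four] at h5
  rw [dartsAt, Finset.sum_insert, Finset.sum_insert, Finset.sum_insert, Finset.sum_singleton]
  · simpa using h2.symm
  · simpa using ⟨h2.symm, h0.symm⟩
  · simpa using ⟨h2.symm, h0.symm, h5⟩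

/-- A function on darts that is constant along the knot is constant. -/
theorem eq_of_edge_of_opposite {α : Type*} (f : P.Dart → α) (he : ∀ d, f (P.edge d) = f d)
    (ho : ∀ d, f (P.rot (P.rot d)) = f d) (d e : P.Dart) : f d = f e := by
  obtain ⟨g, hg, rfl⟩ := P.one_component d e
  suffices h : ∀ d, f (g d) = f d from (h d).symm
  induction hg using Subgroup.closure_induction with
  | mem x hx =>
    rcases hx with rfl | rfl
    · exact he
    · exact ho
  | one => simp
  | mul x y _ _ hx hy => intro d; rw [Equiv.Perm.mul_apply, hx, hy]
  | inv x _ hx => intro d; simpa using (hx (x⁻¹ d)).symm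

theorem card_dartsAt (d : P.Dart) : (dartsAt d).card = 4 := by
  exact (Finset.card_eq_sum_ones _).trans (sum_dartsAt _ d)

theorem card_dart_eq_mul_crossing : Fintype.card P.Dart = 4 * Nat.card P.Crossing := by
  rw [← Finset.card_univ, Finset.card_eq_sum_card_fiberwise (f := P.crossingOf)
    (t := Finset.univ) (by simp), Finset.sum_congr rfl (g := fun _ => 4)]
  · simp [mul_comm]
  · intro c _
    obtain ⟨d, rfl⟩ := crossingOf_surjective c
    rw [filter_crossingOf, card_dartsAt]

theorem card_dart_eq_mul_edge : Fintype.card P.Dart = 2 * Nat.card (PermCycles P.edge) := by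
  let : Fintype (PermCycles P.edge) := Fintype.ofFinite _
  rw [← Finset.card_univ, Finset.card_eq_sum_card_fiberwise
    (f := fun d => (Quotient.mk _ d : PermCycles P.edge))
    (t := Finset.univ) (by simp), Finset.sum_congr rfl (g := fun _ => 2)]
  · simp [mul_comm]
  · intro c _
    obtain ⟨d, rfl⟩ := Quotient.mk_surjective c
    rw [← Finset.card_pair (P.edge_ne d)]
    congr 1
    ext e
    simp only [Finset.mem_filter, Finset.mem_univ, true_and, Finset.mem_insert,
      Finset.mem_singleton]
    constructor
    · intro h
      obtain ⟨n, hn⟩ := (Equiv.Perm.SameCycle.exists_nat_pow_eq (Quotient.exact h.symm))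
      have key : ∀ n : ℕ, (P.edge ^ n) d = P.edge d ∨ (P.edge ^ n) d = d := by
        intro n
        induction n with
        | zero => simp
        | succ k ih =>
          rw [pow_succ', Equiv.Perm.mul_apply]
          rcases ih with h | h <;> simp [h, P.edge_edge]
      rw [← hn]
      exact key n
    · rintro (rfl | rfl)
      · exact Quotient.sound
          ((Equiv.Perm.sameCycle_apply_left (f := P.edge)).2 (Equiv.Perm.SameCycle.refl _ _))
      · rfl

/-- Counting darts gives four per crossing and two per edge, so E = 2V, and V - E + F = 2 becomes F
= V + 2. -/
theorem card_region [h : Nonempty P.Dart] :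
    Fintype.card P.Region = Fintype.card P.Crossing + 2 := by
  have h1 := P.planar h
  have h2 := card_dart_eq_mul_crossing (P := P)
  have h3 := card_dart_eq_mul_edge (P := P)
  have h4 : Nat.card P.Region = Nat.card (PermCycles (P.rot * P.edge)) := by
    have : IsEmpty {_side : Bool // IsEmpty P.Dart} :=
      ⟨fun b => not_isEmpty_of_nonempty P.Dart b.2⟩
    exact Nat.card_congr (Equiv.sumEmpty _ _)
  rw [← Nat.card_eq_fintype_card, ← Nat.card_eq_fintype_card, h4]
  change Nat.card P.Crossing + _ = _ at h1
  omega

/-! ### Corners counted with multiplicity: kernel and surjectivity -/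

variable (P) in
/-- The sum of the values of a function on regions at the four corners of a crossing. -/
def cornerSum : (P.Region → ZMod 2) →ₗ[ZMod 2] (P.Crossing → ZMod 2) where
  toFun x c := ∑ d with P.crossingOf d = c, x (P.regionOf d)
  map_add' x y := by ext c; simp [Finset.sum_add_distrib]
  map_smul' a x := by ext c; simp [Finset.mul_sum]

variable (P) in
/-- The sum of the values of a function on regions at the regions touched by a crossing. -/
def touchSum : (P.Region → ZMod 2) →ₗ[ZMod 2] (P.Crossing → ZMod 2) where
  toFun x c := ∑ R with P.Touches c R, x R
  map_add' x y := by ext c; simp [Finset.sum_add_distrib]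
  map_smul' a x := by ext c; simp [Finset.mul_sum]

theorem cornerSum_crossingOf (x : P.Region → ZMod 2) (d : P.Dart) :
    P.cornerSum x (P.crossingOf d) =
      x (P.regionOf d) + (x (P.regionOf (P.rot d)) + (x (P.regionOf (P.rot (P.rot d)))
        + x (P.regionOf (P.rot (P.rot (P.rot d)))))) := by
  rw [← sum_dartsAt (fun e => x (P.regionOf e)), ← filter_crossingOf]
  rfl

/-- The jump across the curve survives passing to the other end of an edge, which swaps the sides,
and going straight through a crossing, where the corner sum vanishes. With a single component it is
the same everywhere. -/
theorem sides_eq_of_cornerSum_eq_zero {x : P.Region → ZMod 2} (hx : P.cornerSum x = 0)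
    (d e : P.Dart) : x (P.regionOf d) + x (P.regionOf (P.rot d)) =
      x (P.regionOf e) + x (P.regionOf (P.rot e)) := by
  refine eq_of_edge_of_opposite (fun d => x (P.regionOf d) + x (P.regionOf (P.rot d)))
    (fun d => ?_) (fun d => ?_) d e
  · simp only [regionOf_rot_edge, regionOf_edge]
    exact add_comm _ _
  · have h := congrFun hx (P.crossingOf d)
    rw [cornerSum_crossingOf, Pi.zero_apply] at h
    generalize x (P.regionOf d) = a at *
    generalize x (P.regionOf (P.rot d)) = b at *
    generalize x (P.regionOf (P.rot (P.rot d))) = c at *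
    generalize x (P.regionOf (P.rot (P.rot (P.rot d)))) = e at *
    clear hx
    decide +revert

theorem eq_zero_of_cornerSum_eq_zero {x : P.Region → ZMod 2} (hx : P.cornerSum x = 0)
    (d : P.Dart) (h : x (P.regionOf d) = 0) (h' : x (P.regionOf (P.rot d)) = 0) : x = 0 := by
  have : Nonempty P.Dart := ⟨d⟩
  have hs : ∀ e, x (P.regionOf (P.rot e)) = x (P.regionOf e) := by
    intro e
    have := sides_eq_of_cornerSum_eq_zero hx d e
    rw [h, h', add_zero] at this
    exact (CharTwo.add_eq_zero.1 this.symm).symm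
  ext R
  obtain ⟨e, rfl⟩ := regionOf_surjective R
  rw [Pi.zero_apply, ← h]
  exact eq_of_edge_of_opposite (fun d => x (P.regionOf d))
    (fun d => by rw [regionOf_edge, hs]) (fun d => by rw [hs, hs]) e d

/-- The values of a function on regions on the two sides of a dart. -/
def sides (d : P.Dart) : (P.Region → ZMod 2) →ₗ[ZMod 2] (Fin 2 → ZMod 2) where
  toFun x := ![x (P.regionOf d), x (P.regionOf (P.rot d))]
  map_add' x y := by simp
  map_smul' a x := by simp

theorem sides_injective (d : P.Dart) :
    Function.Injective ((sides d).domRestrict (LinearMap.ker P.cornerSum)) := by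
  rw [← LinearMap.ker_eq_bot, LinearMap.ker_eq_bot']
  rintro ⟨x, hx⟩ h
  ext1
  exact eq_zero_of_cornerSum_eq_zero hx d (congrFun h 0) (congrFun h 1)

/-- The kernel embeds in 𝔽₂² and there are two more regions than crossings, so rank-nullity leaves
no room for a cokernel. -/
theorem cornerSum_surjective : Function.Surjective P.cornerSum := by
  rcases isEmpty_or_nonempty P.Dart with h | ⟨⟨d⟩⟩
  · intro u
    refine ⟨0, ?_⟩
    ext c
    obtain ⟨d, rfl⟩ := crossingOf_surjective c
    exact h.elim d
  have : Nonempty P.Dart := ⟨d⟩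
  have h1 := LinearMap.finrank_le_finrank_of_injective (sides_injective d)
  have h2 := P.cornerSum.finrank_range_add_finrank_ker
  rw [Module.finrank_fintype_fun_eq_card, card_region] at h2
  rw [Module.finrank_fintype_fun_eq_card, Fintype.card_fin] at h1
  rw [← LinearMap.range_eq_top]
  apply Submodule.eq_top_of_finrank_eq
  have h3 := Submodule.finrank_le (LinearMap.range P.cornerSum)
  rw [Module.finrank_fintype_fun_eq_card] at h3 ⊢
  omega

theorem sides_surjective (d : P.Dart) :
    Function.Surjective ((sides d).domRestrict (LinearMap.ker P.cornerSum)) := by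
  have : Nonempty P.Dart := ⟨d⟩
  have h2 := P.cornerSum.finrank_range_add_finrank_ker
  rw [Module.finrank_fintype_fun_eq_card, card_region,
    LinearMap.range_eq_top.2 cornerSum_surjective, finrank_top,
    Module.finrank_fintype_fun_eq_card] at h2
  refine (LinearMap.injective_iff_surjective_of_finrank_eq_finrank ?_).1 (sides_injective d)
  rw [Module.finrank_fintype_fun_eq_card, Fintype.card_fin]
  omega

theorem exists_cornerSum_eq_zero (d : P.Dart) (a b : ZMod 2) : ∃ x : P.Region → ZMod 2,
    P.cornerSum x = 0 ∧ x (P.regionOf d) = a ∧ x (P.regionOf (P.rot d)) = b := by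
  obtain ⟨⟨x, hx⟩, h⟩ := sides_surjective d ![a, b]
  exact ⟨x, hx, congrFun h 0, congrFun h 1⟩

/-- The checkerboard coloring, with a prescribed color at one region. -/
theorem exists_checkerboard (d : P.Dart) : ∃ x : P.Region → ZMod 2, x (P.regionOf d) = 0 ∧
    ∀ e, x (P.regionOf (P.rot e)) = x (P.regionOf e) + 1 := by
  obtain ⟨x, hx, h0, h1⟩ := exists_cornerSum_eq_zero d 0 1
  refine ⟨x, h0, fun e => ?_⟩
  have h := sides_eq_of_cornerSum_eq_zero hx d e
  rw [h0, h1] at h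
  generalize x (P.regionOf e) = a at *
  generalize x (P.regionOf (P.rot e)) = b at *
  clear hx h0 h1
  decide +revert

/-! ### Symmetry of interlacement -/

/-- Each edge contributes twice to the alternating pairing of two functions on regions. -/
theorem sum_pairing_eq_zero (x y : P.Region → ZMod 2) :
    ∑ d, (x (P.regionOf d) * y (P.regionOf (P.rot d))
      + x (P.regionOf (P.rot d)) * y (P.regionOf d)) = 0 := by
  rw [Finset.sum_add_distrib, ← Equiv.sum_comp P.edge]
  simp only [regionOf_edge, regionOf_rot_edge]
  exact CharTwo.add_self_eq_zero _

theorem sum_pairing_dartsAt (x y : P.Region → ZMod 2) (d : P.Dart) :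
    ∑ e ∈ dartsAt d, (x (P.regionOf e) * y (P.regionOf (P.rot e))
      + x (P.regionOf (P.rot e)) * y (P.regionOf e)) =
    (x (P.regionOf d) + x (P.regionOf (P.rot (P.rot d)))) * P.cornerSum y (P.crossingOf d) +
    P.cornerSum x (P.crossingOf d) * (y (P.regionOf d) + y (P.regionOf (P.rot (P.rot d)))) := by
  rw [sum_dartsAt, cornerSum_crossingOf, cornerSum_crossingOf, P.rot_four]
  have h : (2 : ZMod 2) = 0 := rfl
  linear_combination (-(x (P.regionOf d) + x (P.regionOf (P.rot (P.rot d)))) *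
    (y (P.regionOf d) + y (P.regionOf (P.rot (P.rot d))))) * h

/-- Interlacement of crossings is symmetric. -/
theorem add_opposite_comm {x y : P.Region → ZMod 2} {d e : P.Dart}
    (hde : P.crossingOf d ≠ P.crossingOf e)
    (hx : P.cornerSum x = Pi.single (P.crossingOf d) 1)
    (hy : P.cornerSum y = Pi.single (P.crossingOf e) 1) :
    x (P.regionOf e) + x (P.regionOf (P.rot (P.rot e))) =
      y (P.regionOf d) + y (P.regionOf (P.rot (P.rot d))) := by
  have h := sum_pairing_eq_zero x y
  rw [← Finset.sum_fiberwise_of_maps_to (g := P.crossingOf) (t := Finset.univ) (by simp),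
    Finset.sum_eq_add (P.crossingOf d) (P.crossingOf e) hde, filter_crossingOf, filter_crossingOf,
    sum_pairing_dartsAt, sum_pairing_dartsAt, hx, hy] at h
  · simp only [Pi.single_eq_same, Pi.single_eq_of_ne hde, Pi.single_eq_of_ne hde.symm, mul_zero,
      zero_mul, one_mul, mul_one, zero_add, add_zero] at h
    exact (CharTwo.add_eq_zero.1 h).symm
  · intro c _ hc
    obtain ⟨f, rfl⟩ := crossingOf_surjective c
    rw [filter_crossingOf, sum_pairing_dartsAt, hx, hy, Pi.single_eq_of_ne hc.1,
      Pi.single_eq_of_ne hc.2, mul_zero, zero_mul, add_zero]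
  · simp
  · simp

/-! ### Lobes at reducible crossings -/

/-- `d` is at a crossing two of whose opposite corners belong to the same region, the one on the
right of `d`, and `x` is a checkerboard coloring of the inside of the lobe of the knot that starts
and ends at this crossing and avoids the edge of `r`. -/
structure IsLobe (r d : P.Dart) (x : P.Region → ZMod 2) : Prop where
  reducible : P.regionOf (P.rot (P.rot d)) = P.regionOf d
  cornerSum : P.cornerSum x = Pi.single (P.crossingOf d) 1
  base : x (P.regionOf d) = 0
  root : x (P.regionOf (P.rot r)) = x (P.regionOf r)

theorem exists_isLobe (r : P.Dart) {d : P.Dart}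
    (h : P.regionOf (P.rot (P.rot d)) = P.regionOf d) : ∃ x, IsLobe r d x := by
  obtain ⟨x, hx⟩ := cornerSum_surjective (Pi.single (P.crossingOf d) 1)
  obtain ⟨y, hy0, hy⟩ := exists_checkerboard d
  have hy2 : P.cornerSum y = 0 := by
    ext c
    obtain ⟨e, rfl⟩ := crossingOf_surjective c
    rw [cornerSum_crossingOf, Pi.zero_apply]
    simp only [hy]
    generalize y (P.regionOf e) = a
    revert a
    decide
  have h1 : P.cornerSum (fun _ => 1) = 0 := by
    ext c
    obtain ⟨e, rfl⟩ := crossingOf_surjective c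
    rw [cornerSum_crossingOf, Pi.zero_apply]
    decide
  -- The kernel of `cornerSum` supplies two corrections: the checkerboard `y` removes the jump at
  -- `r`, and the constant then fixes the value at `d`, where `y` is 0.
  refine ⟨x + (x (P.regionOf r) + x (P.regionOf (P.rot r))) • y +
    x (P.regionOf d) • fun _ => 1, h, ?_, ?_, ?_⟩
  · rw [map_add, map_add, map_smul, map_smul, hy2, h1, hx, smul_zero, smul_zero, add_zero, add_zero]
  · simp [hy0, CharTwo.add_self_eq_zero]
  · have h2 : (2 : ZMod 2) = 0 := rfl
    simp only [Pi.add_apply, Pi.smul_apply, smul_eq_mul, hy]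
    linear_combination x (P.regionOf (P.rot r)) * h2

namespace IsLobe

variable {r d : P.Dart} {x : P.Region → ZMod 2}

/-- A lobe at a reducible crossing is interlaced with no other crossing: by symmetry the jump is
that of `y` between opposite corners at `d`, which lie in the same region. -/
theorem opposite (hx : IsLobe r d x) {e : P.Dart} (he : P.crossingOf e ≠ P.crossingOf d) :
    x (P.regionOf (P.rot (P.rot e))) = x (P.regionOf e) := by
  obtain ⟨y, hy⟩ := cornerSum_surjective (Pi.single (P.crossingOf e) 1)
  have h := add_opposite_comm he.symm hx.cornerSum hy
  rw [hx.reducible, CharTwo.add_self_eq_zero] at h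
  exact (CharTwo.add_eq_zero.1 h).symm

theorem add_rot (hx : IsLobe r d x) :
    x (P.regionOf (P.rot d)) + x (P.regionOf (P.rot (P.rot (P.rot d)))) = 1 := by
  have h := congrFun hx.cornerSum (P.crossingOf d)
  rwa [cornerSum_crossingOf, Pi.single_eq_same, hx.reducible, hx.base, zero_add, zero_add] at h

/-- Inside the lobe, there is only one color of the checkerboard. -/
theorem mul_checkerboard (hx : IsLobe r d x) {y : P.Region → ZMod 2} (hy0 : y (P.regionOf d) = 0)
    (hy : ∀ e, y (P.regionOf (P.rot e)) = y (P.regionOf e) + 1) (R : P.Region) :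
    x R * (1 + y R) = 0 := by
  suffices h : (fun R => x R * (1 + y R)) = 0 from congrFun h R
  -- The product lies in the kernel of `cornerSum`. At the crossing of `d` every corner has `x = 0`
  -- or `y = 1`; elsewhere opposite corners carry equal values and cancel.
  refine eq_zero_of_cornerSum_eq_zero ?_ d ?_ ?_
  · ext c
    obtain ⟨e, rfl⟩ := crossingOf_surjective c
    rw [cornerSum_crossingOf, Pi.zero_apply]
    by_cases he : P.crossingOf e = P.crossingOf d
    · have he' : e ∈ dartsAt d := by rw [← filter_crossingOf]; simpa using he
      have h2 : (1 : ZMod 2) + 1 = 0 := rfl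
      simp only [dartsAt, Finset.mem_insert, Finset.mem_singleton] at he'
      rcases he' with rfl | rfl | rfl | rfl <;>
        simp [P.rot_four, hx.reducible, hx.base, hy, hy0, h2]
    · simp only [hy]
      rw [hx.opposite he, hx.opposite (e := P.rot e) (by rwa [crossingOf_rot])]
      generalize x (P.regionOf e) = a
      generalize x (P.regionOf (P.rot e)) = b
      generalize y (P.regionOf e) = c
      clear * -
      decide +revert
  · simp [hx.base]
  · rw [hy, hy0, zero_add, CharTwo.add_self_eq_zero, mul_zero]

/-- A corner in the colored inside of the lobe is next to a corner that is not in it. -/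
theorem rot_ne_of_eq_one (hx : IsLobe r d x) {e : P.Dart} (h : x (P.regionOf e) = 1) :
    x (P.regionOf (P.rot e)) ≠ 1 := by
  intro h'
  obtain ⟨y, hy0, hy⟩ := exists_checkerboard d
  have h1 := hx.mul_checkerboard hy0 hy (P.regionOf e)
  have h2 := hx.mul_checkerboard hy0 hy (P.regionOf (P.rot e))
  rw [hy, h'] at h2
  rw [h] at h1
  generalize y (P.regionOf e) = a at *
  clear * - h1 h2
  revert a
  decide

end IsLobe

/-- The darts that separate different values of a function on regions. -/
def separating (x : P.Region → ZMod 2) : Finset P.Dart :=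
  {e | x (P.regionOf e) + x (P.regionOf (P.rot e)) = 1}

namespace IsLobe

variable {r d d' : P.Dart} {x x' : P.Region → ZMod 2}

/-- The separating darts are those on the lobe. Both lobes avoid the same root `r`, so a lobe
starting at a crossing on another lobe must be nested inside it. -/
theorem separating_ssubset (hx : IsLobe r d x) (hx' : IsLobe r d' x') (h : x (P.regionOf d') = 1)
    (hne : P.crossingOf d' ≠ P.crossingOf d) : separating x' ⊂ separating x := by
  set y := fun e => x (P.regionOf e) + x (P.regionOf (P.rot e)) with hy
  set y' := fun e => x' (P.regionOf e) + x' (P.regionOf (P.rot e)) with hy'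
  have edge : ∀ e, y (P.edge e) = y e := fun e => by
    simp only [hy, regionOf_edge, regionOf_rot_edge, add_comm]
  have edge' : ∀ e, y' (P.edge e) = y' e := fun e => by
    simp only [hy', regionOf_edge, regionOf_rot_edge, add_comm]
  have rot : ∀ e, P.crossingOf e ≠ P.crossingOf d → y (P.rot e) = y e := fun e he => by
    simp only [hy, hx.opposite he, add_comm]
  have rot' : ∀ e, P.crossingOf e ≠ P.crossingOf d' → y' (P.rot e) = y' e := fun e he => by
    simp only [hy', hx'.opposite he, add_comm]
  have root : y r = 0 := by simp only [hy, hx.root, CharTwo.add_self_eq_zero]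
  have root' : y' r = 0 := by simp only [hy', hx'.root, CharTwo.add_self_eq_zero]
  have at_self : ∀ e, P.crossingOf e = P.crossingOf d' → y e = 1 := by
    have h1 : y d' = 1 := by
      have := hx.rot_ne_of_eq_one h
      simp only [hy, h]
      generalize x (P.regionOf (P.rot d')) = a at *
      clear * - this
      decide +revert
    intro e he
    have he' : e ∈ dartsAt d' := by rw [← filter_crossingOf]; simpa using he
    simp only [dartsAt, Finset.mem_insert, Finset.mem_singleton] at he'
    rcases he' with rfl | rfl | rfl | rfl
    · exact h1
    · rwa [rot _ hne]
    · rwa [rot, rot _ hne]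
      rwa [crossingOf_rot]
    · rwa [rot, rot, rot _ hne]
      · rwa [crossingOf_rot]
      · rwa [crossingOf_rot, crossingOf_rot]
  have at_other : ∀ e, P.crossingOf e = P.crossingOf d → y' e = y' d := by
    intro e he
    have he' : e ∈ dartsAt d := by rw [← filter_crossingOf]; simpa using he
    simp only [dartsAt, Finset.mem_insert, Finset.mem_singleton] at he'
    rcases he' with rfl | rfl | rfl | rfl
    · rfl
    · rw [rot' _ hne.symm]
    · rw [rot', rot' _ hne.symm]
      rw [crossingOf_rot]; exact hne.symm
    · rw [rot', rot', rot' _ hne.symm]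
      · rw [crossingOf_rot]; exact hne.symm
      · rw [crossingOf_rot, crossingOf_rot]; exact hne.symm
  have opp : ∀ e, P.crossingOf e ≠ P.crossingOf d → y (P.rot (P.rot e)) = y e := fun e he => by
    rw [rot, rot _ he]; rwa [crossingOf_rot]
  have opp' : ∀ e, P.crossingOf e ≠ P.crossingOf d' → y' (P.rot (P.rot e)) = y' e := fun e he => by
    rw [rot', rot' _ he]; rwa [crossingOf_rot]
  -- If `d` were on the second lobe, the indicator of the complement of both lobes would be constant
  -- along the knot, yet it is 1 at `r` and 0 at `d`.
  have outer : y' d = 0 := by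
    by_contra h0
    replace h0 : y' d = 1 := by
      generalize y' d = a at *
      clear * - h0
      decide +revert
    have := eq_of_edge_of_opposite (fun e => (1 + y e) * (1 + y' e))
      (fun e => by rw [edge, edge']) (fun e => by
        by_cases he : P.crossingOf e = P.crossingOf d
        · rw [at_other e he, at_other _ (by rwa [crossingOf_rot, crossingOf_rot]), h0,
            CharTwo.add_self_eq_zero, mul_zero, mul_zero]
        by_cases he' : P.crossingOf e = P.crossingOf d'
        · rw [at_self e he', at_self _ (by rwa [crossingOf_rot, crossingOf_rot]),
            CharTwo.add_self_eq_zero, zero_mul, zero_mul]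
        rw [opp e he, opp' e he']) r d
    simp [root, root', h0, CharTwo.add_self_eq_zero] at this
  -- The part of the second lobe outside the first is likewise constant along the knot, and it
  -- misses `r`.
  have key := eq_of_edge_of_opposite (fun e => (1 + y e) * y' e)
      (fun e => by rw [edge, edge']) (fun e => by
        by_cases he : P.crossingOf e = P.crossingOf d
        · rw [at_other e he, at_other _ (by rwa [crossingOf_rot, crossingOf_rot]), outer,
            mul_zero, mul_zero]
        by_cases he' : P.crossingOf e = P.crossingOf d'
        · rw [at_self e he', at_self _ (by rwa [crossingOf_rot, crossingOf_rot]),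
            CharTwo.add_self_eq_zero, zero_mul, zero_mul]
        rw [opp e he, opp' e he']) r
  simp only [root', mul_zero] at key
  rw [Finset.ssubset_iff_of_subset]
  · have h1 : y d + y (P.rot (P.rot d)) = 1 := by
      simp only [hy, hx.reducible, hx.base, zero_add]
      exact hx.add_rot
    have h2 : ∀ a b : ZMod 2, a + b = 1 → a = 1 ∨ b = 1 := by decide
    rcases h2 _ _ h1 with h3 | h3
    · refine ⟨d, by simpa [separating] using h3, fun h4 => ?_⟩
      have h4 : y' d = 1 := by simpa [separating] using h4
      simp [outer] at h4
    · refine ⟨P.rot (P.rot d), by simpa [separating] using h3, fun h4 => ?_⟩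
      have h4 : y' (P.rot (P.rot d)) = 1 := by simpa [separating] using h4
      rw [at_other _ (by rw [crossingOf_rot, crossingOf_rot]), outer] at h4
      simp at h4
  · intro e he
    have h1 : y' e = 1 := by simpa [separating] using he
    have h2 := key e
    have h3 : y e = 1 := by
      rw [h1] at h2
      generalize y e = a at h2
      clear * - h2
      decide +revert
    simpa [separating] using h3

end IsLobe

/-! ### From corners to touched regions -/

theorem touches_crossingOf (d : P.Dart) (R : P.Region) :
    P.Touches (P.crossingOf d) R ↔ R ∈ (dartsAt d).image P.regionOf := by
  rw [← filter_crossingOf, Touches]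
  simp

theorem touchSum_crossingOf (x : P.Region → ZMod 2) (d : P.Dart) :
    P.touchSum x (P.crossingOf d) = ∑ R ∈ (dartsAt d).image P.regionOf, x R := by
  change ∑ R with P.Touches (P.crossingOf d) R, x R = _
  congr 1
  ext R
  simp [touches_crossingOf]

theorem regionOf_rot_ne (d : P.Dart) : P.regionOf (P.rot d) ≠ P.regionOf d := by
  obtain ⟨y, _, hy⟩ := exists_checkerboard d
  intro h
  have := hy d
  rw [h] at this
  simp at this

theorem regionOf_rot_rot_rot_ne (d : P.Dart) :
    P.regionOf (P.rot (P.rot (P.rot d))) ≠ P.regionOf d := by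
  have := regionOf_rot_ne (P.rot (P.rot (P.rot d)))
  rw [P.rot_four] at this
  exact this.symm

theorem touchSum_of_reducible (x : P.Region → ZMod 2) {d : P.Dart}
    (h : P.regionOf (P.rot (P.rot d)) = P.regionOf d) :
    P.touchSum x (P.crossingOf d) = P.cornerSum x (P.crossingOf d) + x (P.regionOf d) := by
  -- If both pairs of opposite corners coincided, every corner sum here would be 0, against
  -- surjectivity.
  have h1 : P.regionOf (P.rot (P.rot (P.rot d))) ≠ P.regionOf (P.rot d) := by
    intro h1
    obtain ⟨z, hz⟩ := cornerSum_surjective (Pi.single (P.crossingOf d) 1)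
    have h2 := congrFun hz (P.crossingOf d)
    rw [cornerSum_crossingOf, Pi.single_eq_same, h1, h] at h2
    generalize z (P.regionOf d) = a at *
    generalize z (P.regionOf (P.rot d)) = b at *
    clear * - h2
    revert a b
    decide
  rw [touchSum_crossingOf, cornerSum_crossingOf, dartsAt]
  simp only [Finset.image_insert, Finset.image_singleton, h]
  rw [Finset.insert_comm, Finset.insert_comm (P.regionOf d) (P.regionOf d), Finset.insert_idem,
    Finset.sum_insert, Finset.sum_insert, Finset.sum_singleton]
  · have h2 : (2 : ZMod 2) = 0 := rfl
    linear_combination -x (P.regionOf d) * h2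
  · simpa using (regionOf_rot_rot_rot_ne d).symm
  · simpa using ⟨regionOf_rot_ne d, h1.symm⟩

theorem touchSum_of_not_reducible (x : P.Region → ZMod 2) (d : P.Dart)
    (h : P.regionOf (P.rot (P.rot d)) ≠ P.regionOf d)
    (h' : P.regionOf (P.rot (P.rot (P.rot d))) ≠ P.regionOf (P.rot d)) :
    P.touchSum x (P.crossingOf d) = P.cornerSum x (P.crossingOf d) := by
  rw [touchSum_crossingOf, cornerSum_crossingOf, dartsAt]
  simp only [Finset.image_insert, Finset.image_singleton]
  rw [Finset.sum_insert, Finset.sum_insert, Finset.sum_insert, Finset.sum_singleton]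
  · simpa using (regionOf_rot_ne (P.rot (P.rot d))).symm
  · simpa using ⟨(regionOf_rot_ne (P.rot d)).symm, h'.symm⟩
  · simpa using ⟨(regionOf_rot_ne d).symm, h.symm, (regionOf_rot_rot_rot_ne d).symm⟩

/-- The two incidence maps differ only at crossings two of whose corners are in one region. -/
theorem touchSum_eq_or (x : P.Region → ZMod 2) (c : P.Crossing) :
    P.touchSum x c = P.cornerSum x c ∨ ∃ d, P.crossingOf d = c ∧
      P.regionOf (P.rot (P.rot d)) = P.regionOf d ∧ x (P.regionOf d) = 1 := by
  have h01 : ∀ a : ZMod 2, a = 0 ∨ a = 1 := by decide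
  have key : ∀ d, P.regionOf (P.rot (P.rot d)) = P.regionOf d →
      P.touchSum x (P.crossingOf d) = P.cornerSum x (P.crossingOf d) ∨ x (P.regionOf d) = 1 := by
    intro d h
    rw [touchSum_of_reducible x h]
    rcases h01 (x (P.regionOf d)) with h0 | h0 <;> simp [h0]
  obtain ⟨d, rfl⟩ := crossingOf_surjective c
  by_cases h : P.regionOf (P.rot (P.rot d)) = P.regionOf d
  · exact (key d h).imp_right fun h1 => ⟨d, rfl, h, h1⟩
  by_cases h' : P.regionOf (P.rot (P.rot (P.rot d))) = P.regionOf (P.rot d)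
  · rw [← crossingOf_rot d]
    exact (key (P.rot d) h').imp_right fun h1 => ⟨P.rot d, rfl, h', h1⟩
  · exact Or.inl (touchSum_of_not_reducible x d h h')

theorem mem_range_touchSum {v : P.Crossing → ZMod 2}
    (h : ∀ c, v c ≠ 0 → Pi.single c 1 ∈ LinearMap.range P.touchSum) :
    v ∈ LinearMap.range P.touchSum := by
  rw [pi_eq_sum_univ' v]
  refine Submodule.sum_mem _ fun c _ => ?_
  by_cases hc : v c = 0
  · rw [hc, zero_smul]
    exact Submodule.zero_mem _
  · exact Submodule.smul_mem _ _ (h c hc)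

/-- Induction on the length of the lobe: `touchSum x` differs from the target only at reducible
crossings where the shared region has value 1, and their lobes are strictly shorter. At `d` itself
`base` rules out an error. -/
theorem IsLobe.single_mem_range {r d : P.Dart} {x : P.Region → ZMod 2} (hx : IsLobe r d x) :
    Pi.single (P.crossingOf d) 1 ∈ LinearMap.range P.touchSum := by
  induction hn : (separating x).card using Nat.strong_induction_on generalizing d x with
  | _ n ih =>
    rw [← sub_sub_cancel (P.touchSum x) (Pi.single (P.crossingOf d) 1), ← hx.cornerSum]
    refine Submodule.sub_mem _ ⟨x, rfl⟩ (mem_range_touchSum fun c hc => ?_)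
    rcases touchSum_eq_or x c with h | ⟨d', rfl, h, h1⟩
    · simp [h] at hc
    obtain ⟨x', hx'⟩ := exists_isLobe r h
    refine ih _ ?_ hx' rfl
    rw [← hn]
    refine Finset.card_lt_card (hx.separating_ssubset hx' h1 fun hdd => hc ?_)
    rw [Pi.sub_apply, hdd, touchSum_of_reducible x hx.reducible, hx.base, add_zero, sub_self]

/-- Every set of crossings is the set of crossings changed by region crossing changes about some
set of regions. -/
theorem touchSum_surjective : Function.Surjective P.touchSum := by
  rw [← LinearMap.range_eq_top, eq_top_iff]
  intro v _
  refine mem_range_touchSum fun c _ => ?_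
  obtain ⟨x, hx⟩ := cornerSum_surjective (Pi.single c 1)
  rw [← sub_sub_cancel (P.touchSum x) (Pi.single c 1), ← hx]
  refine Submodule.sub_mem _ ⟨x, rfl⟩ (mem_range_touchSum fun c hc => ?_)
  rcases touchSum_eq_or x c with h | ⟨d, rfl, h, _⟩
  · simp [h] at hc
  -- Any dart can serve as the root here.
  obtain ⟨x', hx'⟩ := exists_isLobe d h
  exact hx'.single_mem_range

theorem card_ker_touchSum [Nonempty P.Dart] : Nat.card (LinearMap.ker P.touchSum) = 4 := by
  have h := P.touchSum.finrank_range_add_finrank_ker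
  rw [LinearMap.range_eq_top.2 touchSum_surjective, finrank_top,
    Module.finrank_fintype_fun_eq_card, Module.finrank_fintype_fun_eq_card, card_region] at h
  rw [Module.natCard_eq_pow_finrank (K := ZMod 2), Nat.card_zmod, Nat.add_left_cancel h]
  rfl

theorem touchSum_apply (x : P.Region → ZMod 2) (c : P.Crossing) :
    P.touchSum x c = ∑ R with P.Touches c R, x R := rfl

theorem touchSum_single (R : P.Region) (c : P.Crossing) :
    P.touchSum (Pi.single R 1) c = if P.Touches c R then 1 else 0 := by
  rw [touchSum_apply, Finset.sum_pi_single']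
  simp

/-! ### Parity and indicator functions -/

variable (P) in
/-- The number modulo 2 of regions in a set given by its indicator function. -/
def parity : (P.Region → ZMod 2) →ₗ[ZMod 2] ZMod 2 where
  toFun x := ∑ R, x R
  map_add' x y := by simp [Finset.sum_add_distrib]
  map_smul' a x := by simp [Finset.mul_sum]

theorem parity_single (R : P.Region) : P.parity (Pi.single R 1) = 1 := by
  simp [parity]

/-- The indicator function of a set of regions. -/
def indicator (𝓡 : Finset P.Region) : P.Region → ZMod 2 := ∑ R ∈ 𝓡, Pi.single R 1

theorem indicator_apply (𝓡 : Finset P.Region) (R : P.Region) :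
    indicator 𝓡 R = if R ∈ 𝓡 then 1 else 0 := by
  simp [indicator, Finset.sum_apply, Pi.single_apply]

theorem indicator_bijective : Function.Bijective (indicator (P := P)) := by
  constructor
  · intro S T h
    ext R
    have := congrFun h R
    rw [indicator_apply, indicator_apply] at this
    by_cases h1 : R ∈ S <;> by_cases h2 : R ∈ T <;> simp_all
  · intro x
    refine ⟨Finset.univ.filter (fun R => x R = 1), ?_⟩
    ext R
    rw [indicator_apply]
    simp only [Finset.mem_filter, Finset.mem_univ, true_and]
    generalize x R = a
    revert a
    decide

theorem parity_indicator (𝓡 : Finset P.Region) : P.parity (indicator 𝓡) = (𝓡.card : ZMod 2) := by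
  simp [indicator, map_sum, parity_single]

/-! ### Crossing changes as vectors over 𝔽₂ -/

namespace Diagram

/-- The crossing changes at the crossings where `u` is `1`. -/
def changeAt (u : P.Crossing → ZMod 2) (D : P.Diagram) : P.Diagram := D.change {c | u c = 1}

theorem changeAt_injective (D : P.Diagram) : Function.Injective fun u => D.changeAt u := by
  intro u v h
  ext c
  obtain ⟨d, rfl⟩ := crossingOf_surjective c
  have h1 := iff_of_eq (congrFun (congrArg Diagram.isOver h) d)
  have h2 : u (P.crossingOf d) = 1 ↔ v (P.crossingOf d) = 1 := by
    simp only [changeAt, change, Xor, Set.mem_ofPred_eq] at h1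
    tauto
  generalize u (P.crossingOf d) = a at h2
  generalize v (P.crossingOf d) = b at h2
  clear * - h2
  decide +revert

theorem changeAt_zero (D : P.Diagram) : D.changeAt 0 = D := by
  ext d
  simp [changeAt, change, Xor]

theorem changeAt_changeAt (u v : P.Crossing → ZMod 2) (D : P.Diagram) :
    (D.changeAt u).changeAt v = D.changeAt (u + v) := by
  ext d
  simp only [changeAt, change, Xor, Set.mem_ofPred_eq, Pi.add_apply]
  have h : ∀ a b : ZMod 2, a + b = 1 ↔ (a = 1 ∧ ¬ b = 1) ∨ (b = 1 ∧ ¬ a = 1) := by decide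
  rw [h]
  tauto

theorem crossingChange_eq (c : P.Crossing) (D : P.Diagram) :
    D.crossingChange c = D.changeAt (Pi.single c 1) := by
  rw [crossingChange, changeAt]
  congr 1
  ext c'
  simp [Pi.single_apply]

theorem rcc_eq (R : P.Region) (D : P.Diagram) :
    D.rcc R = D.changeAt (P.touchSum (Pi.single R 1)) := by
  rw [rcc, changeAt]
  congr 1
  ext c
  simp [touchSum_single]

/-- The crossings changed by region freeze crossing changes. -/
def _root_.KnotProjection.freezeSum (x : P.Region → ZMod 2) : P.Crossing → ZMod 2 :=
  P.touchSum x + fun _ => P.parity x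

theorem rfcc_eq (R : P.Region) (D : P.Diagram) :
    D.rfcc R = D.changeAt (freezeSum (Pi.single R 1)) := by
  rw [rfcc, changeAt]
  congr 1
  ext c
  simp only [freezeSum, Pi.add_apply, touchSum_single, parity_single, Set.mem_ofPred_eq]
  by_cases h : P.Touches c R <;> simp [h, CharTwo.add_self_eq_zero]

theorem rccAbout_eq (𝓡 : Finset P.Region) (D : P.Diagram) :
    D.rccAbout 𝓡 = D.changeAt (P.touchSum (indicator 𝓡)) := by
  have h : ∀ s : Multiset P.Region, s.foldr rcc D =
      D.changeAt (P.touchSum (s.map fun R => Pi.single R 1).sum) := by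
    intro s
    induction s using Multiset.induction with
    | empty => simp [changeAt_zero]
    | cons R s ih =>
      rw [Multiset.foldr_cons, ih, rcc_eq, changeAt_changeAt, Multiset.map_cons,
        Multiset.sum_cons, map_add, add_comm]
  exact h _

theorem rfccSeq_eq (l : List P.Region) (D : P.Diagram) :
    D.rfccSeq l = D.changeAt (freezeSum (l.map fun R => Pi.single R 1).sum) := by
  unfold rfccSeq
  induction l generalizing D with
  | nil =>
    have : freezeSum (0 : P.Region → ZMod 2) = 0 := by
      ext c
      simp [freezeSum]
    simp [this, changeAt_zero]
  | cons R l ih =>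
    rw [List.foldl_cons, ih, rfcc_eq, changeAt_changeAt, List.map_cons, List.sum_cons]
    congr 1
    ext c
    simp only [freezeSum, map_add, Pi.add_apply]
    ring

theorem exists_rfccSeq_iff (D : P.Diagram) (c : P.Crossing) :
    (∃ l : List P.Region, D.rfccSeq l = D.crossingChange c) ↔
      ∃ x, freezeSum x = (Pi.single c 1 : P.Crossing → ZMod 2) := by
  simp only [rfccSeq_eq, crossingChange_eq, D.changeAt_injective.eq_iff]
  refine ⟨fun ⟨l, hl⟩ => ⟨_, hl⟩, fun ⟨x, hx⟩ => ?_⟩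
  obtain ⟨𝓡, rfl⟩ := indicator_bijective.2 x
  refine ⟨𝓡.toList, ?_⟩
  rwa [Finset.sum_map_toList]

theorem rccRealizes_iff (D : P.Diagram) (𝓡 : Finset P.Region) (c : P.Crossing) :
    D.RccRealizes 𝓡 c ↔ P.touchSum (indicator 𝓡) = Pi.single c 1 := by
  rw [RccRealizes, rccAbout_eq, crossingChange_eq, D.changeAt_injective.eq_iff]

theorem ineffective_iff (D : P.Diagram) (𝓡 : Finset P.Region) :
    D.Ineffective 𝓡 ↔ P.touchSum (indicator 𝓡) = 0 := by
  have h := D.changeAt_injective.eq_iff (a := P.touchSum (indicator 𝓡)) (b := 0)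
  simp only [changeAt_zero] at h
  rw [Ineffective, rccAbout_eq, h]

theorem ncard_rccRealizes [Nonempty P.Dart] (D : P.Diagram) (c : P.Crossing) :
    {𝓡 : Finset P.Region | D.RccRealizes 𝓡 c}.ncard = 4 := by
  obtain ⟨s, hs⟩ := touchSum_surjective (Pi.single c 1 : P.Crossing → ZMod 2)
  rw [← card_ker_touchSum (P := P), ← Nat.card_coe_set_eq]
  refine Nat.card_congr (Equiv.ofBijective
    (fun 𝓡 => ⟨indicator 𝓡.1 - s, ?_⟩) ⟨fun 𝓡 𝓢 h => ?_, fun x => ?_⟩)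
  · rw [LinearMap.mem_ker, map_sub, hs, (rccRealizes_iff D 𝓡.1 c).1 𝓡.2, sub_self]
  · exact Subtype.ext (indicator_bijective.1 (sub_left_injective (congrArg Subtype.val h)))
  · obtain ⟨𝓡, h⟩ := indicator_bijective.2 (x.1 + s)
    refine ⟨⟨𝓡, (rccRealizes_iff D 𝓡 c).2 ?_⟩, Subtype.ext ?_⟩
    · rw [h, map_add, LinearMap.mem_ker.1 x.2, hs, zero_add]
    · simp [h]

theorem parity_eq_zero_of_touchSum_eq_zero {D : P.Diagram}
    (heven : ∀ 𝓡 : Finset P.Region, D.Ineffective 𝓡 → Even 𝓡.card) {x : P.Region → ZMod 2}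
    (hx : P.touchSum x = 0) : P.parity x = 0 := by
  obtain ⟨𝓡, rfl⟩ := indicator_bijective.2 x
  rw [parity_indicator, ZMod.natCast_eq_zero_iff_even]
  exact heven 𝓡 ((ineffective_iff D 𝓡).2 hx)

/-- On the crossing-free circle a single region is already an ineffective set of odd size. -/
theorem nonempty_dart {D : P.Diagram}
    (heven : ∀ 𝓡 : Finset P.Region, D.Ineffective 𝓡 → Even 𝓡.card) : Nonempty P.Dart := by
  by_contra h
  rw [not_nonempty_iff] at h
  have := heven {Sum.inr ⟨true, h⟩} (by
    ext d
    exact h.elim d)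
  simp at this

/-- Two solutions differ by a kernel element, which has parity 0, so any solution decides (⋆). -/
theorem star_iff {D : P.Diagram}
    (heven : ∀ 𝓡 : Finset P.Region, D.Ineffective 𝓡 → Even 𝓡.card) {c : P.Crossing}
    {x : P.Region → ZMod 2} (hx : P.touchSum x = Pi.single c 1) :
    D.Star c ↔ P.parity x = 1 := by
  constructor
  · rintro ⟨𝓡, hodd, h⟩
    rw [rccRealizes_iff] at h
    have h1 := parity_eq_zero_of_touchSum_eq_zero heven (x := x - indicator 𝓡)
      (by rw [map_sub, hx, h, sub_self])
    rwa [map_sub, parity_indicator, ZMod.natCast_eq_one_iff_odd.2 hodd, sub_eq_zero] at h1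
  · intro h
    obtain ⟨𝓡, rfl⟩ := indicator_bijective.2 x
    rw [parity_indicator, ZMod.natCast_eq_one_iff_odd] at h
    exact ⟨𝓡, h, (rccRealizes_iff D 𝓡 c).2 hx⟩

theorem forall_exists_rfccSeq_iff {D : P.Diagram}
    (heven : ∀ 𝓡 : Finset P.Region, D.Ineffective 𝓡 → Even 𝓡.card) :
    (∀ c : P.Crossing, ∃ l : List P.Region, D.rfccSeq l = D.crossingChange c) ↔
      Even {c : P.Crossing | D.Star c}.ncard := by
  simp only [exists_rfccSeq_iff]
  choose s hs using fun c : P.Crossing =>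
    touchSum_surjective (Pi.single c 1 : P.Crossing → ZMod 2)
  have hstar : (({c : P.Crossing | D.Star c}.ncard : ℕ) : ZMod 2) = ∑ c, P.parity (s c) := by
    rw [Set.ncard_eq_toFinset_card', Finset.card_eq_sum_ones, Nat.cast_sum,
      Set.toFinset_ofPred, Finset.sum_filter]
    refine Finset.sum_congr rfl fun c _ => ?_
    rw [star_iff heven (hs c)]
    have h01 : ∀ a : ZMod 2, a = 0 ∨ a = 1 := by decide
    rcases h01 (P.parity (s c)) with h | h <;> simp [h]
  rw [← ZMod.natCast_eq_zero_iff_even, hstar]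
  -- This is parity = φ ∘ `touchSum`, with φ(e_c) = `P.parity (s c)`.
  have hpar : ∀ x, P.parity x = ∑ c, P.touchSum x c * P.parity (s c) := by
    intro x
    have h : P.touchSum (x - ∑ c, P.touchSum x c • s c) = 0 := by
      rw [map_sub, map_sum, sub_eq_zero]
      simp only [map_smul, hs]
      exact pi_eq_sum_univ' _
    have h1 := parity_eq_zero_of_touchSum_eq_zero heven h
    rw [map_sub, map_sum, sub_eq_zero] at h1
    simpa only [map_smul, smul_eq_mul] using h1
  constructor
  · intro h
    by_contra h0
    have h1 : ∑ c, P.parity (s c) = 1 := by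
      generalize ∑ c, P.parity (s c) = a at h0
      clear * - h0
      decide +revert
    -- With p the parity of a freeze solution for c, applying φ gives p = φ(e_c) + p φ(𝟙) = φ(e_c) +
    -- p. So φ(e_c) = 0 for every c, contradicting φ(𝟙) = 1.
    refine h0 (Finset.sum_eq_zero fun c _ => ?_)
    obtain ⟨x, hx⟩ := h c
    have h2 : P.touchSum x = Pi.single c 1 + fun _ => P.parity x := by
      rw [← hx, freezeSum]
      ext c'
      simp [add_assoc, CharTwo.add_self_eq_zero]
    have h3 := hpar x
    simp only [h2, Pi.add_apply, add_mul, Finset.sum_add_distrib, ← Finset.mul_sum, h1] at h3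
    simpa [Pi.single_apply] using h3
  · intro h c
    -- The added multiple of a lift of 𝟙 cancels the parity term of `freezeSum`; its own parity is a
    -- multiple of φ(𝟙) = 0.
    refine ⟨s c + P.parity (s c) • ∑ c', s c', ?_⟩
    ext c'
    simp only [freezeSum, map_add, map_smul, map_sum, h, hs, Pi.add_apply,
      Pi.smul_apply, Finset.sum_apply, smul_eq_mul]
    simp [Finset.sum_pi_single, add_assoc, CharTwo.add_self_eq_zero]

end Diagram

end KnotProjection

end

theorem mainTheorem2 (P : KnotProjection) (D : P.Diagram)
    (heven : ∀ 𝓡 : Finset P.Region, D.Ineffective 𝓡 → Even 𝓡.card) :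
    ((∀ c : P.Crossing, ∃ l : List P.Region, D.rfccSeq l = D.crossingChange c) ↔
      Even {c : P.Crossing | D.Star c}.ncard) ∧
    ∀ c : P.Crossing, D.Star c →
      {𝓡 : Finset P.Region | D.RccRealizes 𝓡 c}.ncard = 4 ∧
      ∀ 𝓡 : Finset P.Region, D.RccRealizes 𝓡 c → Odd 𝓡.card := by
  have := KnotProjection.Diagram.nonempty_dart heven
  refine ⟨KnotProjection.Diagram.forall_exists_rfccSeq_iff heven, fun c hc =>
    ⟨D.ncard_rccRealizes c, fun 𝓡 h𝓡 => ?_⟩⟩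
  rw [← ZMod.natCast_eq_one_iff_odd, ← KnotProjection.parity_indicator]
  exact (KnotProjection.Diagram.star_iff heven ((D.rccRealizes_iff 𝓡 c).1 h𝓡)).1 hc
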